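/- All graphs are finite, simple and undirected. For a connected graph $G$ and $m\ge 1$, a locating $m$-coloring of $G$ is a proper vertex coloring $c:V(G)\to\{1,\dots,m\}$ (adjacent vertices get different colors), with every color class $C_i=c^{-1}(i)$ nonempty, such that distinct vertices $v$ have distinct color codes $(d(v,C_1),\dots,d(v,C_m))$, where $d(v,C_i)=\min\{d(v,x) : x\in C_i\}$. The locating-chromatic number $\chi_L(G)$ is the smallest positive integer $m$ such that $G$ has a locating $m$-coloring. For $n\ge 2$ and $k\ge 1$, the $k$-level $n$-ary tree $T(n,k)$ is defined recursively: $T(n,1)$ is the star with $n$ leaves, and for $k\ge 2$, $T(n,k)$ is obtained by joining a new vertex (the center of $T(n,k)$) to the centers of $n$ disjoint copies of $T(n,k-1)$. Then for every integer $k\ge 4$, $$\lim_{n\to\infty}\bigl(\chi_L(T(n,k))-n\bigr)=k-1.$$ -/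

import Mathlib

/-- The distance `d(v, C_i) = min {d(v, x) | x ∈ C_i}` from `v` to the color class
`C_i = {x | c x = i}`. (For a connected graph and a nonempty class this is a genuine minimum.) -/
noncomputable def distToClass {V : Type*} (G : SimpleGraph V) {m : ℕ} (c : V → Fin m)
    (v : V) (i : Fin m) : ℕ :=
  sInf {d : ℕ | ∃ x : V, c x = i ∧ d = G.dist v x}

/-- The color code of `v`: the ordered `m`-tuple of distances to the color classes. -/
noncomputable def colorCode {V : Type*} (G : SimpleGraph V) {m : ℕ} (c : V → Fin m)
    (v : V) : Fin m → ℕ :=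
  fun i => distToClass G c v i

/-- A locating `m`-coloring: adjacent vertices get different colors, the `m` color classes form
a partition of the vertex set (each is nonempty), and distinct vertices have distinct color
codes. -/
structure IsLocatingColoring {V : Type*} (G : SimpleGraph V) {m : ℕ} (c : V → Fin m) : Prop where
  proper : ∀ u v : V, G.Adj u v → c u ≠ c v
  surjective : Function.Surjective c
  code_injective : Function.Injective (colorCode G c)

/-- The locating-chromatic number: the least positive `m` such that `G` has a locating
`m`-coloring. -/
noncomputable def locatingChromaticNumber {V : Type*} (G : SimpleGraph V) : ℕ :=
  sInf {m : ℕ | 0 < m ∧ ∃ c : V → Fin m, IsLocatingColoring G c}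

/-- Take `n` disjoint copies of a graph `G` with a distinguished vertex `r`, and join a new
vertex `none` to the copy of `r` in each of them. -/
def joinNewRoot (n : ℕ) {V : Type} (G : SimpleGraph V) (r : V) :
    SimpleGraph (Option (Fin n × V)) where
  Adj x y :=
    match x, y with
    | none, none => False
    | none, some (_, v) => v = r
    | some (_, u), none => u = r
    | some (i, u), some (j, v) => i = j ∧ G.Adj u v
  symm := ⟨by
    rintro (_ | ⟨i, u⟩) (_ | ⟨j, v⟩) h
    · exact h
    · exact h
    · exact h
    · exact ⟨h.1.symm, h.2.symm⟩⟩
  loopless := ⟨by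
    rintro (_ | ⟨i, u⟩) h
    · exact h
    · exact G.loopless.irrefl u h.2⟩

/-- The vertices of the `k`-level `n`-ary tree. -/
def NaryVertex (n : ℕ) : ℕ → Type
  | 0 => Unit
  | k + 1 => Option (Fin n × NaryVertex n k)

/-- The center (root) of the `k`-level `n`-ary tree. -/
def naryRoot (n : ℕ) : (k : ℕ) → NaryVertex n k
  | 0 => ()
  | _ + 1 => none

/-- The `k`-level `n`-ary tree `T(n, k)`: a new vertex joined to the centers of `n` disjoint
copies of `T(n, k - 1)`. The recursion starts from the one-vertex tree at `k = 0`, so that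
`T(n, 1)` is the star `S_n` with `n` leaves. -/
def naryTree (n : ℕ) : (k : ℕ) → SimpleGraph (NaryVertex n k)
  | 0 => ⊥
  | k + 1 => joinNewRoot n (naryTree n k) (naryRoot n k)

/-! For large `n` and `k = s + 3`, the value is exactly `n + s + 2`.

Lower bound. Leaves with a common neighbour `w` need distinct colors, so the code of `w` has at
least `n` entries equal to 1. With `m ≤ n + s + 1` colors, at most `s + 1` entries are free, each of
bounded size. This allows only O(n^(s+1)) codes, while there are n^(s+2) such vertices `w`
(`card_le_of_colorCode`, `le_of_isLocatingColoring`).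

Upper bound. Color from the root down. The children of a vertex get distinct colors f(0), …, f(n-1).
Child `i` gets the color cyclically after f(i), and f(i) is withheld from its whole subtree unless
fewer than two levels remain below it. A vertex at depth d in that subtree is then at distance d + 2
from f(i), by way of the sibling colored f(i). For d ≥ 1, this exceeds the distance from vertices of
the same depth in other branches and from all shallower vertices, so codes reveal both depth and
branch. Withholding costs one color per level, which the palette affords. Available colors left
unused by the children are forced on the grandchildren, so every available color lies within
distance 2. The intended codes are shown to be the true ones by local conditions
(`distToClass_eq_of_local`). -/

/-! ### Distances to color classes and counting of codes -/

section Generic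

variable {V : Type*} {G : SimpleGraph V} {m : ℕ} {c : V → Fin m}

theorem distToClass_le (G : SimpleGraph V) (c : V → Fin m) (v x : V) :
    distToClass G c v (c x) ≤ G.dist v x :=
  Nat.sInf_le ⟨x, rfl, rfl⟩

theorem exists_dist_eq_distToClass (G : SimpleGraph V) (v : V) {i : Fin m}
    (h : ∃ x, c x = i) : ∃ x, c x = i ∧ distToClass G c v i = G.dist v x := by
  obtain ⟨x, hx⟩ := h
  exact Nat.sInf_mem (s := {d : ℕ | ∃ x : V, c x = i ∧ d = G.dist v x}) ⟨_, x, hx, rfl⟩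

theorem exists_dist_le_of_local (hG : G.Connected) {i : Fin m} (D : V → ℕ)
    (hzero : ∀ v, D v = 0 ↔ c v = i) (hdesc : ∀ v, D v ≠ 0 → ∃ w, G.Adj v w ∧ D v = D w + 1)
    (v : V) : ∃ x, c x = i ∧ G.dist v x ≤ D v := by
  induction hd : D v generalizing v with
  | zero => exact ⟨v, (hzero v).1 hd, by simp⟩
  | succ d ih =>
    obtain ⟨w, hw, hd'⟩ := hdesc v (by omega)
    obtain ⟨x, hx, hle⟩ := ih w (by omega)
    refine ⟨x, hx, ?_⟩
    have h1 := hG.dist_triangle (u := v) (v := w) (w := x)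
    have h2 := SimpleGraph.dist_eq_one_iff_adj.2 hw
    omega

/-- A function that vanishes exactly on a color class, is `1`-Lipschitz along edges, and decreases
along some edge wherever it is nonzero, is the distance to that class. -/
theorem distToClass_eq_of_local (hG : G.Connected) {i : Fin m} (D : V → ℕ)
    (hzero : ∀ v, D v = 0 ↔ c v = i) (hlip : ∀ u v, G.Adj u v → D u ≤ D v + 1)
    (hdesc : ∀ v, D v ≠ 0 → ∃ w, G.Adj v w ∧ D v = D w + 1) (v : V) :
    distToClass G c v i = D v := by
  have hwalk : ∀ u v (p : G.Walk u v), D u ≤ D v + p.length := by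
    intro u v p
    induction p with
    | nil => simp
    | cons h p ih =>
      have := hlip _ _ h
      simp only [SimpleGraph.Walk.length_cons]
      omega
  obtain ⟨x, hx, hle⟩ := exists_dist_le_of_local hG D hzero hdesc v
  apply le_antisymm
  · subst hx
    exact (distToClass_le G c v x).trans hle
  · obtain ⟨y, hy, he⟩ := exists_dist_eq_distToClass G v ⟨x, hx⟩
    obtain ⟨p, hp⟩ := hG.exists_walk_length_eq_dist v y
    have := hwalk _ _ p
    rw [(hzero y).2 hy] at this
    omega

theorem dist_eq_succ_of_pendant (hG : G.Connected) {l w x : V}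
    (hl : ∀ y, G.Adj l y ↔ y = w) (hx : x ≠ l) : G.dist l x = G.dist w x + 1 := by
  apply le_antisymm
  · have h1 := hG.dist_triangle (u := l) (v := w) (w := x)
    have h2 := SimpleGraph.dist_eq_one_iff_adj.2 ((hl w).2 rfl)
    omega
  · obtain ⟨p, hp⟩ := hG.exists_walk_length_eq_dist l x
    cases p with
    | nil => exact absurd rfl hx
    | cons h p =>
      obtain rfl := (hl _).1 h
      have := SimpleGraph.dist_le p
      simp only [SimpleGraph.Walk.length_cons] at hp
      omega

/-- Every path out of a pendant vertex starts through its neighbour, so the two leaves are equally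
far from every vertex of another color. -/
theorem IsLocatingColoring.pendant_eq (hG : G.Connected) (hc : IsLocatingColoring G c)
    {l l' w : V} (hl : ∀ y, G.Adj l y ↔ y = w) (hl' : ∀ y, G.Adj l' y ↔ y = w)
    (h : c l = c l') : l = l' := by
  apply hc.code_injective
  funext i
  by_cases hi : c l = i
  · have h1 := distToClass_le G c l l
    have h2 := distToClass_le G c l' l'
    rw [SimpleGraph.dist_self] at h1 h2
    rw [← h, hi] at h2
    rw [hi] at h1
    simp only [colorCode]
    omega
  · have : ∀ x, c x = i → G.dist l x = G.dist l' x := by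
      intro x hx
      rw [dist_eq_succ_of_pendant hG hl (by rintro rfl; exact hi hx),
        dist_eq_succ_of_pendant hG hl' (by rintro rfl; exact hi (h.trans hx))]
    simp only [colorCode, distToClass]
    congr 1
    ext d
    constructor
    · rintro ⟨x, hx, rfl⟩
      exact ⟨x, hx, this x hx⟩
    · rintro ⟨x, hx, rfl⟩
      exact ⟨x, hx, (this x hx).symm⟩

/-- A vertex with `n` pendant neighbours has at least `n` entries `1` in its color code. -/
theorem IsLocatingColoring.card_code_ne_one_le (hG : G.Connected) (hc : IsLocatingColoring G c)
    {n : ℕ} {w : V} {l : Fin n → V} (hinj : Function.Injective l)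
    (hl : ∀ i y, G.Adj (l i) y ↔ y = w) :
    (Finset.univ.filter fun q => colorCode G c w q ≠ 1).card + n ≤ m := by
  have hone : ∀ i, colorCode G c w (c (l i)) = 1 := by
    intro i
    have hadj := ((hl i w).2 rfl).symm
    obtain ⟨x, hx, he⟩ := exists_dist_eq_distToClass (c := c) G w ⟨l i, rfl⟩
    have hle := distToClass_le G c w (l i)
    rw [SimpleGraph.dist_eq_one_iff_adj.2 hadj] at hle
    have hne : G.dist w x ≠ 0 := by
      intro h0
      rw [hG.dist_eq_zero_iff] at h0
      subst h0
      exact hc.proper _ _ hadj hx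
    simp only [colorCode]
    omega
  have hcard : (Finset.univ.image fun i => c (l i)).card = n := by
    rw [Finset.card_image_of_injective, Finset.card_fin]
    intro i j hij
    exact hinj (hc.pendant_eq hG (hl i) (hl j) hij)
  have hsub : (Finset.univ.image fun i => c (l i)) ⊆
      Finset.univ.filter fun q => ¬ colorCode G c w q ≠ 1 := by
    intro q hq
    obtain ⟨i, -, rfl⟩ := Finset.mem_image.1 hq
    simp [hone]
  have h1 := Finset.card_le_card hsub
  have h2 := Finset.card_filter_add_card_filter_not (s := (Finset.univ : Finset (Fin m)))
    (fun q => colorCode G c w q ≠ 1)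
  rw [Finset.card_fin] at h2
  omega

/-- Counting color codes that take the value `1` outside at most `r` colors. -/
theorem card_le_of_colorCode {ι : Type*} [Fintype ι] {b r : ℕ} [NeZero m] (w : ι → V)
    (hinj : Function.Injective fun p => colorCode G c (w p))
    (hb : ∀ p q, colorCode G c (w p) q < b)
    (hr : ∀ p, (Finset.univ.filter fun q => colorCode G c (w p) q ≠ 1).card ≤ r) :
    Fintype.card ι ≤ (m * b) ^ r := by
  have key : ∀ p, ∃ t : Fin r → Fin m, ∀ q, colorCode G c (w p) q ≠ 1 → ∃ j, t j = q := by
    intro p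
    set B := Finset.univ.filter fun q => colorCode G c (w p) q ≠ 1 with hB
    -- Padding the list with 0 is harmless: each listed position is later recorded with its true
    -- code value, and unlisted entries are 1.
    refine ⟨fun j => if h : (j : ℕ) < B.card then (B.equivFin.symm ⟨j, h⟩ : Fin m) else 0, ?_⟩
    intro q hq
    have hqB : q ∈ B := by simp [hB, hq]
    refine ⟨⟨B.equivFin ⟨q, hqB⟩, (B.equivFin ⟨q, hqB⟩).2.trans_le (hr p)⟩, ?_⟩
    simp
  choose t ht using key
  have hE : Function.Injective fun (p : ι) (j : Fin r) =>
      ((t p j, ⟨colorCode G c (w p) (t p j), hb _ _⟩) : Fin m × Fin b) := by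
    have aux : ∀ p p', (∀ j, t p j = t p' j ∧
        colorCode G c (w p) (t p j) = colorCode G c (w p') (t p' j)) →
        ∀ q, colorCode G c (w p) q ≠ 1 → colorCode G c (w p) q = colorCode G c (w p') q := by
      intro p p' h q hq
      obtain ⟨j, rfl⟩ := ht p q hq
      rw [(h j).2, (h j).1]
    intro p p' h
    have h' : ∀ j, t p j = t p' j ∧
        colorCode G c (w p) (t p j) = colorCode G c (w p') (t p' j) := by
      intro j
      simpa using congrFun h j
    apply hinj
    funext q
    by_cases h1 : colorCode G c (w p) q = 1
    · by_cases h2 : colorCode G c (w p') q = 1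
      · simp [h1, h2]
      · exact (aux p' p (fun j => ⟨(h' j).1.symm, (h' j).2.symm⟩) q h2).symm
    · exact aux p p' h' q h1
  simpa using Fintype.card_le_of_injective _ hE

end Generic

/-! ### The tree and the lower bound -/

section Tree

theorem reachable_naryRoot (n : ℕ) :
    ∀ (s : ℕ) (v : NaryVertex n s),
      ∃ p : (naryTree n s).Walk (naryRoot n s) v, p.length ≤ s
  | 0, _ => ⟨SimpleGraph.Walk.nil, le_rfl⟩
  | s + 1, none => ⟨SimpleGraph.Walk.nil, Nat.zero_le _⟩
  | s + 1, some (i, v) => by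
    obtain ⟨p, hp⟩ := reachable_naryRoot n s v
    let φ : naryTree n s →g naryTree n (s + 1) :=
      ⟨fun v => (some (i, v) : Option (Fin n × NaryVertex n s)), fun h => ⟨rfl, h⟩⟩
    have hadj : (naryTree n (s + 1)).Adj (naryRoot n (s + 1)) (φ (naryRoot n s)) := rfl
    refine ⟨SimpleGraph.Walk.cons hadj (p.map φ), ?_⟩
    exact Nat.succ_le_succ ((p.length_map φ).trans_le hp)

theorem naryTree_connected (n s : ℕ) : (naryTree n s).Connected := by
  rw [SimpleGraph.connected_iff_exists_forall_reachable]
  exact ⟨naryRoot n s, fun v => ⟨(reachable_naryRoot n s v).choose⟩⟩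

theorem naryTree_dist_le (n s : ℕ) (u v : NaryVertex n s) : (naryTree n s).dist u v ≤ 2 * s := by
  obtain ⟨p, hp⟩ := reachable_naryRoot n s u
  obtain ⟨q, hq⟩ := reachable_naryRoot n s v
  have h1 := (naryTree_connected n s).dist_triangle (u := u) (v := naryRoot n s) (w := v)
  have h2 := SimpleGraph.dist_le p
  have h3 := SimpleGraph.dist_le q
  rw [SimpleGraph.dist_comm] at h2
  omega

/-- The vertices `w p` are the parents of leaves, addressed by their path from the root. The
induction needs the leaves to avoid the root, since the old root gains a neighbour at each level. -/
theorem exists_pendant_family (n : ℕ) :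
    ∀ s : ℕ, ∃ (w : (Fin s → Fin n) → NaryVertex n (s + 1))
      (l : (Fin s → Fin n) → Fin n → NaryVertex n (s + 1)),
      Function.Injective w ∧ ∀ p, Function.Injective (l p) ∧ ∀ i,
        l p i ≠ naryRoot n (s + 1) ∧ ∀ y, (naryTree n (s + 1)).Adj (l p i) y ↔ y = w p
  | 0 => by
    refine ⟨fun _ => (none : Option (Fin n × NaryVertex n 0)),
      fun _ i => (some (i, ()) : Option (Fin n × NaryVertex n 0)), ?_, fun p => ⟨?_, fun i => ⟨?_, ?_⟩⟩⟩
    · exact fun p q _ => Subsingleton.elim _ _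
    · intro i j h
      exact (Prod.mk.inj (Option.some.inj h)).1
    · exact Option.some_ne_none _
    · rintro (_ | ⟨j, v⟩)
      · exact ⟨fun _ => rfl, fun _ => rfl⟩
      · exact ⟨fun h => h.2.elim, fun h => (Option.some_ne_none _ h).elim⟩
  | s + 1 => by
    obtain ⟨w, l, hw, hl⟩ := exists_pendant_family n s
    refine ⟨fun p => (some (p 0, w (Fin.tail p)) : Option (Fin n × NaryVertex n (s + 1))),
      fun p i => (some (p 0, l (Fin.tail p) i) : Option (Fin n × NaryVertex n (s + 1))),
      ?_, fun p => ⟨?_, fun i => ⟨?_, ?_⟩⟩⟩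
    · intro p q h
      obtain ⟨h0, h1⟩ := Prod.mk.inj (Option.some.inj h)
      rw [← Fin.cons_self_tail p, ← Fin.cons_self_tail q, h0, hw h1]
    · intro i j h
      exact (hl _).1 (Prod.mk.inj (Option.some.inj h)).2
    · exact Option.some_ne_none _
    · obtain ⟨hne, hadj⟩ := (hl (Fin.tail p)).2 i
      rintro (_ | ⟨j, v⟩)
      · exact ⟨fun h => (hne h).elim, fun h => (Option.some_ne_none _ h.symm).elim⟩
      · constructor
        · intro h
          have h1 : p 0 = j := h.1
          have h2 : v = w (Fin.tail p) := (hadj v).1 h.2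
          subst h1 h2
          rfl
        · intro h
          obtain ⟨h1, h2⟩ := Prod.mk.inj (Option.some.inj h)
          exact ⟨h1.symm, (hadj v).2 h2⟩

theorem pow_le_of_isLocatingColoring {n s m r : ℕ} (hm : 0 < m) (hmr : m ≤ n + r)
    {c : NaryVertex n (s + 1) → Fin m} (hc : IsLocatingColoring (naryTree n (s + 1)) c) :
    n ^ s ≤ (m * (2 * (s + 1) + 1)) ^ r := by
  have : NeZero m := ⟨hm.ne'⟩
  obtain ⟨w, l, hw, hl⟩ := exists_pendant_family n s
  have hconn := naryTree_connected n (s + 1)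
  have := card_le_of_colorCode (G := naryTree n (s + 1)) (c := c) (b := 2 * (s + 1) + 1) (r := r) w
    (hc.code_injective.comp hw) ?_ ?_
  · simpa using this
  · intro p q
    obtain ⟨x, rfl⟩ := hc.surjective q
    exact Nat.lt_succ_of_le ((distToClass_le _ c (w p) x).trans (naryTree_dist_le n (s + 1) _ _))
  · intro p
    have := hc.card_code_ne_one_le hconn (hl p).1 (fun i => ((hl p).2 i).2)
    omega

theorem le_of_isLocatingColoring {n s m : ℕ} (hm : 0 < m) (hn : s + 1 ≤ n)
    (hlarge : (2 * (2 * (s + 3) + 1)) ^ (s + 1) < n)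
    {c : NaryVertex n (s + 3) → Fin m} (hc : IsLocatingColoring (naryTree n (s + 3)) c) :
    n + s + 2 ≤ m := by
  by_contra! hlt
  -- The exponent on the left is `s + 2` against `s + 1` on the right, so one factor `n` survives
  -- the cancellation.
  have h1 := pow_le_of_isLocatingColoring (r := s + 1) hm (by omega) hc
  have h2 : (m * (2 * (s + 3) + 1)) ^ (s + 1) ≤ (n * (2 * (2 * (s + 3) + 1))) ^ (s + 1) := by
    apply Nat.pow_le_pow_left
    have : m ≤ 2 * n := by omega
    calc m * (2 * (s + 3) + 1) ≤ 2 * n * (2 * (s + 3) + 1) := Nat.mul_le_mul_right _ this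
      _ = _ := by ring
  have h3 := h1.trans h2
  rw [mul_pow, pow_succ n (s + 1)] at h3
  have := Nat.le_of_mul_le_mul_left h3 (Nat.pow_pos (by omega))
  omega

end Tree

/-! ### Palette states and their invariants -/

/-- The data at a vertex that governs the coloring of the subtree below it: its color, the color of
its parent, the distances to the colors that do not occur in the subtree (`0` for the colors that
are available), and the colors which must occur among its children. -/
structure PaletteState (α : Type*) where
  color : α
  parent : α
  miss : α → ℕ
  pending : Finset α

namespace PaletteState

variable {α : Type*} [Fintype α] [DecidableEq α] {n s : ℕ}

/-- The colors that may occur in the subtree, other than that of its root. -/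
def available (σ : PaletteState α) : Finset α :=
  Finset.univ.filter fun q => σ.miss q = 0 ∧ q ≠ σ.color

theorem mem_available {σ : PaletteState α} {q : α} :
    q ∈ σ.available ↔ σ.miss q = 0 ∧ q ≠ σ.color := by
  simp [available]

/-- `n` distinct available colors that cover the pending ones. -/
def IsFamily (σ : PaletteState α) (f : Fin n → α) : Prop :=
  Function.Injective f ∧ (∀ i, f i ∈ σ.available) ∧ ∀ q ∈ σ.pending, ∃ i, f i = q

open Classical in
/-- The colors of the children. -/
noncomputable def family (n : ℕ) (σ : PaletteState α) : Fin n → α :=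
  if h : ∃ f : Fin n → α, σ.IsFamily f then h.choose else fun _ => σ.color

open Classical in
/-- The state at the `i`-th child when `s` levels remain below it. That child misses the color of
the child before it. -/
noncomputable def child (n s : ℕ) (σ : PaletteState α) (i : Fin n) : PaletteState α where
  color := σ.family n (finRotate n i)
  parent := σ.color
  -- A missing color is reached only through the parent, hence the increment. A newly withheld one
  -- is at distance 2, on a sibling.
  miss q := if σ.miss q ≠ 0 then σ.miss q + 1 else if 2 ≤ s ∧ q = σ.family n i then 2 else 0
  pending := σ.available.filter fun q => ∀ i, σ.family n i ≠ q

open Classical in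
/-- The intended color code of the vertex when `s` levels remain below it. -/
noncomputable def code (n s : ℕ) (σ : PaletteState α) (q : α) : ℕ :=
  if q = σ.color then 0 else if q = σ.parent then 1 else
    if 0 < s ∧ ∃ i, σ.family n i = q then 1 else if σ.miss q = 0 then 2 else σ.miss q

/-- The invariants of the states. -/
structure Valid (n s : ℕ) (σ : PaletteState α) : Prop where
  miss_color : σ.miss σ.color = 0
  miss_parent : σ.miss σ.parent = 0
  miss_ne_one : ∀ q, σ.miss q ≠ 1
  pending_subset : σ.pending ⊆ σ.available
  card_pending : σ.pending.card ≤ s - 1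
  -- The surplus over `n` pays for the withheld colors; truncated subtraction matches the end of
  -- withholding near the leaves.
  card_available : σ.available.card = n + (s - 2)

theorem Valid.family_spec {σ : PaletteState α} (h : σ.Valid n s) (hs : s ≤ n) :
    σ.IsFamily (σ.family n) := by
  have : ∃ f : Fin n → α, σ.IsFamily f := by
    obtain ⟨t, h1, h2, h3⟩ := Finset.exists_subsuperset_card_eq h.pending_subset
      (n := n) (by have := h.card_pending; omega) (by have := h.card_available; omega)
    let e := t.equivFinOfCardEq h3
    refine ⟨fun i => e.symm i, ?_, fun i => h2 (e.symm i).2, fun q hq => ⟨e ⟨q, h1 hq⟩, by simp⟩⟩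
    exact Subtype.val_injective.comp e.symm.injective
  rw [family, dif_pos this]
  exact this.choose_spec

theorem Valid.family_injective {σ : PaletteState α} (h : σ.Valid n s) (hs : s ≤ n) :
    Function.Injective (σ.family n) :=
  (h.family_spec hs).1

theorem Valid.miss_family {σ : PaletteState α} (h : σ.Valid n s) (hs : s ≤ n) (i : Fin n) :
    σ.miss (σ.family n i) = 0 :=
  (mem_available.1 ((h.family_spec hs).2.1 i)).1

theorem Valid.family_ne_color {σ : PaletteState α} (h : σ.Valid n s) (hs : s ≤ n) (i : Fin n) :
    σ.family n i ≠ σ.color :=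
  (mem_available.1 ((h.family_spec hs).2.1 i)).2

/-- The number of available colors that the children do not use. -/
theorem Valid.card_unused {σ : PaletteState α} (h : σ.Valid n s) (hs : s ≤ n) (i : Fin n) :
    (σ.child n (s - 1) i).pending.card = s - 2 := by
  classical
  have h1 : (σ.child n (s - 1) i).pending = σ.available \ Finset.univ.image (σ.family n) := by
    ext q
    simp [child]
  rw [h1, Finset.card_sdiff_of_subset, h.card_available,
    Finset.card_image_of_injective _ (h.family_injective hs), Finset.card_fin]
  · omega
  · intro q hq
    obtain ⟨i, -, rfl⟩ := Finset.mem_image.1 hq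
    exact (h.family_spec hs).2.1 i

theorem Valid.exists_family_eq {σ : PaletteState α} (h : σ.Valid n 1) (hn : 1 ≤ n) {q : α}
    (h0 : σ.miss q = 0) (hq : q ≠ σ.color) : ∃ i, σ.family n i = q := by
  by_contra! hne
  have := h.card_unused hn ⟨0, hn⟩
  rw [Finset.card_eq_zero] at this
  have hmem : q ∈ (σ.child n (1 - 1) ⟨0, hn⟩).pending := by
    simp only [child, Finset.mem_filter, mem_available]
    exact ⟨⟨h0, hq⟩, hne⟩
  exact absurd (this ▸ hmem) (Finset.notMem_empty q)

theorem finRotate_ne_self (hn : 2 ≤ n) (i : Fin n) : finRotate n i ≠ i := by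
  obtain ⟨n, rfl⟩ := Nat.exists_eq_add_of_le' hn
  rw [finRotate_apply]
  simp

/-- The child's palette gains the parent's color and loses its own color and, if `2 ≤ s`, the
withheld one. -/
theorem Valid.child {σ : PaletteState α} (h : σ.Valid n (s + 1)) (hn : 2 ≤ n) (hs : s + 1 ≤ n)
    (i : Fin n) : (σ.child n s i).Valid n s where
  miss_color := by
    have h1 := h.miss_family hs (finRotate n i)
    have h2 := (h.family_injective hs).ne (finRotate_ne_self hn i)
    simp [PaletteState.child, h1, h2, -finRotate_apply]
  miss_parent := by
    have h1 := (h.family_ne_color hs i).symm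
    simp [PaletteState.child, h1, h.miss_color]
  miss_ne_one q := by
    simp only [PaletteState.child]
    split_ifs <;> omega
  pending_subset q hq := by
    simp only [PaletteState.child, Finset.mem_filter, mem_available] at hq ⊢
    obtain ⟨⟨h1, h2⟩, h3⟩ := hq
    exact ⟨by simp [h1, (h3 i).symm], (h3 _).symm⟩
  card_pending := (h.card_unused hs i).le
  card_available := by
    have h1 := h.miss_family hs
    have h2 := h.family_ne_color hs
    have h3 := (h.family_injective hs).ne (finRotate_ne_self hn i)
    have hav := h.card_available
    have hc : σ.color ∉ σ.available := by simp [mem_available]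
    by_cases h2s : 2 ≤ s
    · have heq : (σ.child n s i).available =
          ((insert σ.color σ.available).erase (σ.family n i)).erase
            (σ.family n (finRotate n i)) := by
        ext q
        simp only [mem_available, PaletteState.child, Finset.mem_erase, Finset.mem_insert]
        by_cases hq : q = σ.color
        · subst hq
          simp [h.miss_color, (h2 _).symm]
        · by_cases hm : σ.miss q = 0 <;> (simp [hm, hq, h2s]; try tauto)
      rw [heq, Finset.card_erase_of_mem, Finset.card_erase_of_mem, Finset.card_insert_of_notMem hc]
      · omega
      · simp [mem_available, h1, h2]
      · simp [mem_available, h1, h2, h3, -finRotate_apply]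
    · have heq : (σ.child n s i).available =
          (insert σ.color σ.available).erase (σ.family n (finRotate n i)) := by
        ext q
        simp only [mem_available, PaletteState.child, Finset.mem_erase, Finset.mem_insert]
        by_cases hq : q = σ.color
        · subst hq
          simp [h.miss_color, (h2 _).symm]
        · by_cases hm : σ.miss q = 0 <;> simp [hm, hq, h2s]
      rw [heq, Finset.card_erase_of_mem, Finset.card_insert_of_notMem hc]
      · omega
      · simp [mem_available, h1, h2]

/-! ### Local behavior of the intended codes -/

theorem Valid.code_eq_zero_iff {σ : PaletteState α} (h : σ.Valid n s) {q : α} :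
    σ.code n s q = 0 ↔ σ.color = q := by
  by_cases hq : q = σ.color
  · simp [code, hq]
  · simp only [code, hq, if_false]
    have : σ.color ≠ q := Ne.symm hq
    split_ifs <;> simp only [this, iff_false] <;> omega

theorem Valid.code_of_miss {σ : PaletteState α} (h : σ.Valid n s) (hs : s ≤ n) {q : α}
    (hq : σ.miss q ≠ 0) : σ.code n s q = σ.miss q := by
  have h1 : q ≠ σ.color := fun e => hq (e ▸ h.miss_color)
  have h2 : q ≠ σ.parent := fun e => hq (e ▸ h.miss_parent)
  have h3 : ∀ i, σ.family n i ≠ q := fun i e => hq (e ▸ h.miss_family hs i)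
  simp [code, *]

theorem code_le_two {σ : PaletteState α} {q : α} (hq : σ.miss q = 0) : σ.code n s q ≤ 2 := by
  simp only [code, hq, if_true]
  split_ifs <;> omega

theorem code_parent_le_one (σ : PaletteState α) : σ.code n s σ.parent ≤ 1 := by
  simp only [code, if_true]
  split_ifs <;> omega

theorem code_family_le_one (σ : PaletteState α) (i : Fin n) :
    σ.code n (s + 1) (σ.family n i) ≤ 1 := by
  have : 0 < s + 1 ∧ ∃ j, σ.family n j = σ.family n i := ⟨s.succ_pos, i, rfl⟩
  rw [code, if_pos this]
  split_ifs <;> omega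

/-- A leaf has a single neighbour. This identifies branches at the bottom, where no color is
withheld. -/
theorem Valid.eq_parent_of_code_leaf {σ : PaletteState α} (h : σ.Valid n 0) {q : α}
    (hq : σ.code n 0 q = 1) : q = σ.parent := by
  have := h.miss_ne_one q
  by_contra hne
  simp only [code, hne, lt_irrefl, false_and, if_false] at hq
  split_ifs at hq <;> omega

theorem miss_child_of_miss {σ : PaletteState α} {q : α} (hq : σ.miss q ≠ 0) (i : Fin n) :
    (σ.child n s i).miss q = σ.miss q + 1 := by
  simp [PaletteState.child, hq]

theorem Valid.miss_child_family {σ : PaletteState α} (h : σ.Valid n (s + 1)) (hs : s + 1 ≤ n)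
    (h2 : 2 ≤ s) (i : Fin n) : (σ.child n s i).miss (σ.family n i) = 2 := by
  simp [PaletteState.child, h.miss_family hs, h2]

theorem miss_child_of_ne {σ : PaletteState α} {q : α} (hq : σ.miss q = 0) {i : Fin n}
    (hi : q ≠ σ.family n i) : (σ.child n s i).miss q = 0 := by
  simp [PaletteState.child, hq, hi]

theorem eq_family_of_miss_child {σ : PaletteState α} {q : α} (hq : σ.miss q = 0) {i : Fin n}
    (hi : (σ.child n s i).miss q ≠ 0) : q = σ.family n i ∧ (σ.child n s i).miss q = 2 := by
  by_cases h : 2 ≤ s ∧ q = σ.family n i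
  · refine ⟨h.2, ?_⟩
    rw [PaletteState.child]
    simp only [hq]
    rw [if_pos h]
    simp
  · simp [PaletteState.child, hq, h] at hi

theorem Valid.code_pos {σ : PaletteState α} (h : σ.Valid n s) {q : α} (hq : q ≠ σ.color) :
    1 ≤ σ.code n s q :=
  Nat.one_le_iff_ne_zero.2 fun h0 => hq (h.code_eq_zero_iff.1 h0).symm

/-- Along an edge the codes differ by at most one. -/
theorem Valid.code_child_close {σ : PaletteState α} (h : σ.Valid n (s + 1)) (hn : 2 ≤ n)
    (hs : s + 1 ≤ n) (i : Fin n) (q : α) :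
    σ.code n (s + 1) q ≤ (σ.child n s i).code n s q + 1 ∧
      (σ.child n s i).code n s q ≤ σ.code n (s + 1) q + 1 := by
  have hv := h.child hn hs i
  by_cases h0 : σ.miss q = 0
  · by_cases hc : q = σ.color
    · have h1 : σ.code n (s + 1) q = 0 := h.code_eq_zero_iff.2 hc.symm
      have h2 : (σ.child n s i).code n s q ≤ 1 := hc ▸ (σ.child n s i).code_parent_le_one
      omega
    by_cases hc' : q = (σ.child n s i).color
    · have h1 : (σ.child n s i).code n s q = 0 := hv.code_eq_zero_iff.2 hc'.symm
      have h2 : σ.code n (s + 1) q ≤ 1 := hc' ▸ σ.code_family_le_one _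
      omega
    have h1 := h.code_pos hc
    have h2 := hv.code_pos hc'
    have h3 := code_le_two (n := n) (s := s + 1) h0
    by_cases hm : (σ.child n s i).miss q = 0
    · have h4 := code_le_two (n := n) (s := s) hm
      omega
    · have h4 := (hv.code_of_miss (by omega) hm).trans (eq_family_of_miss_child h0 hm).2
      omega
  · have h1 := h.code_of_miss hs h0
    have h2 := miss_child_of_miss (s := s) h0 i
    have h3 := hv.code_of_miss (by omega) (q := q) (by omega)
    omega

/-- From a child, the distance decreases towards the parent for the colors that are not met below
the child. -/
theorem Valid.code_child_eq_succ {σ : PaletteState α} (h : σ.Valid n (s + 1)) (hn : 2 ≤ n)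
    (hs : s + 1 ≤ n) (i : Fin n) {q : α} (hq : (σ.child n s i).code n s q ≠ 0)
    (hr : q = (σ.child n s i).parent ∨ (σ.child n s i).miss q ≠ 0 ∨ s = 0) :
    (σ.child n s i).code n s q = σ.code n (s + 1) q + 1 := by
  have hv := h.child hn hs i
  have hclose := h.code_child_close hn hs i q
  by_cases hp : q = σ.color
  · have := h.code_eq_zero_iff.2 hp.symm
    omega
  have hpos := h.code_pos hp
  by_cases hm : (σ.child n s i).miss q = 0
  · obtain hr | hr | rfl := hr
    · exact absurd hr hp
    · exact absurd hm hr
    · have h0 : σ.miss q = 0 := by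
        by_contra h0
        have := miss_child_of_miss (s := 0) h0 i
        omega
      obtain ⟨j, rfl⟩ := h.exists_family_eq (by omega) h0 hp
      have h1 := σ.code_family_le_one (s := 0) j
      have h2 : (σ.child n 0 i).code n 0 (σ.family n j) ≠ 1 := fun e =>
        hp (hv.eq_parent_of_code_leaf e)
      omega
  · have h1 := hv.code_of_miss (by omega) hm
    by_cases h0 : σ.miss q = 0
    · obtain ⟨h2, h3⟩ := eq_family_of_miss_child h0 hm
      have h4 : σ.code n (s + 1) q ≤ 1 := h2 ▸ σ.code_family_le_one _
      omega
    · have h2 := miss_child_of_miss (s := s) h0 i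
      have h3 := h.code_of_miss hs h0
      omega

/-- Every available color is met among the children or the grandchildren. -/
theorem Valid.exists_child_code_succ {σ : PaletteState α} (h : σ.Valid n (s + 1)) (hn : 2 ≤ n)
    (hs : s + 1 ≤ n) {q : α} (h0 : σ.miss q = 0) (hc : q ≠ σ.color) (hp : q ≠ σ.parent) :
    ∃ i, σ.code n (s + 1) q = (σ.child n s i).code n s q + 1 := by
  have hpos := h.code_pos hc
  by_cases hf : ∃ i, σ.family n i = q
  · obtain ⟨i, rfl⟩ := hf
    -- The shift is undone because child `j` carries the color `σ.family n (finRotate n j)`.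
    refine ⟨(finRotate n).symm i, ?_⟩
    have h1 := σ.code_family_le_one (s := s) i
    have h2 := ((h.child hn hs ((finRotate n).symm i)).code_eq_zero_iff
      (q := σ.family n i)).2 (by simp only [PaletteState.child, Equiv.apply_symm_apply])
    omega
  · obtain _ | s := s
    · exact absurd (h.exists_family_eq (by omega) h0 hc) hf
    have hne : ∀ i, σ.family n i ≠ q := fun i e => hf ⟨i, e⟩
    let i : Fin n := ⟨0, by omega⟩
    have hv := h.child hn hs i
    have hmem : q ∈ (σ.child n (s + 1) i).pending := by
      simp only [PaletteState.child, Finset.mem_filter, mem_available]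
      exact ⟨⟨h0, hc⟩, hne⟩
    obtain ⟨j, hj⟩ := (hv.family_spec (by omega)).2.2 q hmem
    have h1 : (σ.child n (s + 1) i).code n (s + 1) q ≤ 1 :=
      hj ▸ (σ.child n (s + 1) i).code_family_le_one j
    have h2 := hv.code_pos (q := q) (hne _).symm
    have h3 : σ.code n (s + 1 + 1) q = 2 := by
      simp [code, hc, hp, hf, h0]
    exact ⟨i, by omega⟩

end PaletteState

/-! ### Coloring and codes of the whole tree -/

namespace PaletteState

variable {α : Type*} [Fintype α] [DecidableEq α] {n : ℕ}

/-- The coloring of the tree with `s` levels whose root is in a given state. -/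
noncomputable def treeColor (n : ℕ) : (s : ℕ) → PaletteState α → NaryVertex n s → α
  | 0, σ, _ => σ.color
  | _ + 1, σ, none => σ.color
  | s + 1, σ, some (i, v) => treeColor n s (σ.child n s i) v

/-- The intended color codes of the tree with `s` levels whose root is in a given state. -/
noncomputable def treeCode (n : ℕ) : (s : ℕ) → PaletteState α → NaryVertex n s → α → ℕ
  | 0, σ, _ => σ.code n 0
  | s + 1, σ, none => σ.code n (s + 1)
  | s + 1, σ, some (i, v) => treeCode n s (σ.child n s i) v

end PaletteState

/-- The distance of a vertex from the root. -/
def naryDepth (n : ℕ) : (s : ℕ) → NaryVertex n s → ℕ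
  | 0, _ => 0
  | _ + 1, none => 0
  | s + 1, some (_, v) => naryDepth n s v + 1

theorem eq_naryRoot_of_depth {n : ℕ} : ∀ {s : ℕ} {v : NaryVertex n s},
    naryDepth n s v = 0 → v = naryRoot n s
  | 0, _, _ => rfl
  | _ + 1, none, _ => rfl
  | _ + 1, some (_, _), h => absurd h (Nat.succ_ne_zero _)

namespace PaletteState

variable {α : Type*} [Fintype α] [DecidableEq α] {n : ℕ}

theorem treeColor_root : ∀ (s : ℕ) (σ : PaletteState α),
    σ.treeColor n s (naryRoot n s) = σ.color
  | 0, _ => rfl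
  | _ + 1, _ => rfl

theorem treeCode_root : ∀ (s : ℕ) (σ : PaletteState α),
    σ.treeCode n s (naryRoot n s) = σ.code n s
  | 0, _ => rfl
  | _ + 1, _ => rfl

theorem Valid.treeCode_eq_zero_iff (hn : 2 ≤ n) {q : α} :
    ∀ {s : ℕ} {σ : PaletteState α}, σ.Valid n s → s ≤ n → ∀ v : NaryVertex n s,
      σ.treeCode n s v q = 0 ↔ σ.treeColor n s v = q
  | 0, _, h, _, _ => h.code_eq_zero_iff
  | _ + 1, _, h, _, none => h.code_eq_zero_iff
  | _ + 1, _, h, hs, some (i, v) =>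
    (h.child hn hs i).treeCode_eq_zero_iff hn (by omega) v

theorem Valid.treeColor_ne (hn : 2 ≤ n) :
    ∀ {s : ℕ} {σ : PaletteState α}, σ.Valid n s → s ≤ n → ∀ u v : NaryVertex n s,
      (naryTree n s).Adj u v → σ.treeColor n s u ≠ σ.treeColor n s v
  | 0, _, _, _, _, _, hadj => hadj.elim
  | _ + 1, _, _, _, none, none, hadj => hadj.elim
  | s + 1, σ, h, hs, none, some (i, v), hadj => by
    obtain rfl : v = naryRoot n s := hadj
    exact (treeColor_root s (σ.child n s i)).symm ▸ (h.family_ne_color hs _).symm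
  | s + 1, σ, h, hs, some (i, v), none, hadj => by
    obtain rfl : v = naryRoot n s := hadj
    exact (treeColor_root s (σ.child n s i)).symm ▸ h.family_ne_color hs _
  | s + 1, σ, h, hs, some (i, u), some (j, v), hadj => by
    obtain ⟨rfl, hadj⟩ : i = j ∧ (naryTree n s).Adj u v := hadj
    exact (h.child hn hs i).treeColor_ne hn (by omega) u v hadj

theorem Valid.treeCode_le_succ (hn : 2 ≤ n) {q : α} :
    ∀ {s : ℕ} {σ : PaletteState α}, σ.Valid n s → s ≤ n → ∀ u v : NaryVertex n s,
      (naryTree n s).Adj u v → σ.treeCode n s u q ≤ σ.treeCode n s v q + 1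
  | 0, _, _, _, _, _, hadj => hadj.elim
  | _ + 1, _, _, _, none, none, hadj => hadj.elim
  | s + 1, σ, h, hs, none, some (i, v), hadj => by
    obtain rfl : v = naryRoot n s := hadj
    exact (treeCode_root s (σ.child n s i)).symm ▸ (h.code_child_close hn hs i q).1
  | s + 1, σ, h, hs, some (i, v), none, hadj => by
    obtain rfl : v = naryRoot n s := hadj
    have := (h.code_child_close hn hs i q).2
    rw [← treeCode_root s (σ.child n s i)] at this
    exact this
  | s + 1, σ, h, hs, some (i, u), some (j, v), hadj => by
    obtain ⟨rfl, hadj⟩ : i = j ∧ (naryTree n s).Adj u v := hadj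
    exact (h.child hn hs i).treeCode_le_succ hn (by omega) u v hadj

/-- The second alternative is the case where the next step may have to leave the subtree upwards; it
is resolved one level higher by `code_child_eq_succ`. -/
theorem Valid.exists_adj_treeCode (hn : 2 ≤ n) {q : α} :
    ∀ {s : ℕ} {σ : PaletteState α}, σ.Valid n s → s ≤ n → ∀ v : NaryVertex n s,
      σ.treeCode n s v q ≠ 0 →
      (∃ w, (naryTree n s).Adj v w ∧ σ.treeCode n s v q = σ.treeCode n s w q + 1) ∨
        v = naryRoot n s ∧ (q = σ.parent ∨ σ.miss q ≠ 0 ∨ s = 0)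
  | 0, _, _, _, _, _ => Or.inr ⟨rfl, Or.inr (Or.inr rfl)⟩
  | s + 1, σ, h, hs, none, hq => by
    by_cases hp : q = σ.parent
    · exact Or.inr ⟨rfl, Or.inl hp⟩
    by_cases hm : σ.miss q = 0
    · obtain ⟨i, hi⟩ := h.exists_child_code_succ hn hs hm
        (fun e => hq (h.code_eq_zero_iff.2 e.symm)) hp
      rw [← treeCode_root s (σ.child n s i)] at hi
      exact Or.inl ⟨(some (i, naryRoot n s) : Option (Fin n × NaryVertex n s)), rfl, hi⟩
    · exact Or.inr ⟨rfl, Or.inr (Or.inl hm)⟩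
  | s + 1, σ, h, hs, some (i, v), hq => by
    obtain ⟨w, hadj, hw⟩ | ⟨rfl, hr⟩ :=
      (h.child hn hs i).exists_adj_treeCode hn (by omega) v hq
    · exact Or.inl ⟨(some (i, w) : Option (Fin n × NaryVertex n s)), ⟨rfl, hadj⟩, hw⟩
    · have hq' : (σ.child n s i).code n s q ≠ 0 := by
        rw [← treeCode_root s (σ.child n s i)]
        exact hq
      have := h.code_child_eq_succ hn hs i hq' hr
      rw [← treeCode_root s (σ.child n s i)] at this
      exact Or.inl ⟨(none : Option (Fin n × NaryVertex n s)), rfl, this⟩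

theorem Valid.treeCode_of_miss (hn : 2 ≤ n) {q : α} :
    ∀ {s : ℕ} {σ : PaletteState α}, σ.Valid n s → s ≤ n → σ.miss q ≠ 0 → ∀ v : NaryVertex n s,
      σ.treeCode n s v q = σ.miss q + naryDepth n s v
  | 0, _, h, hs, hq, _ => h.code_of_miss hs hq
  | _ + 1, _, h, hs, hq, none => h.code_of_miss hs hq
  | s + 1, σ, h, hs, hq, some (i, v) => by
    have h1 := miss_child_of_miss (n := n) (s := s) hq i
    have h2 := (h.child hn hs i).treeCode_of_miss hn (q := q) (by omega) (by omega) v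
    change (σ.child n s i).treeCode n s v q = σ.miss q + (naryDepth n s v + 1)
    omega

/-- A color available at the root can first go missing at depth 1, with value 2, and then grows by
one per level. -/
theorem Valid.treeCode_le (hn : 2 ≤ n) {q : α} :
    ∀ {s : ℕ} {σ : PaletteState α}, σ.Valid n s → s ≤ n → σ.miss q = 0 → ∀ v : NaryVertex n s,
      σ.treeCode n s v q ≤ max 2 (naryDepth n s v + 1)
  | 0, _, _, _, hq, _ => (code_le_two hq).trans (le_max_left _ _)
  | _ + 1, _, _, _, hq, none => (code_le_two hq).trans (le_max_left _ _)
  | s + 1, σ, h, hs, hq, some (i, v) => by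
    change (σ.child n s i).treeCode n s v q ≤ max 2 (naryDepth n s v + 1 + 1)
    by_cases hm : (σ.child n s i).miss q = 0
    · have := (h.child hn hs i).treeCode_le hn (by omega) hm v
      omega
    · have h1 := (h.child hn hs i).treeCode_of_miss hn (by omega) hm v
      have h2 := (eq_family_of_miss_child hq hm).2
      omega

theorem Valid.treeCode_family (hn : 2 ≤ n) {s : ℕ} {σ : PaletteState α} (h : σ.Valid n (s + 1))
    (hs : s + 1 ≤ n) (h2 : 2 ≤ s) (i : Fin n) (v : NaryVertex n s) :
    (σ.child n s i).treeCode n s v (σ.family n i) = naryDepth n s v + 2 := by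
  have h1 := h.miss_child_family hs h2 i
  rw [(h.child hn hs i).treeCode_of_miss hn (by omega) (by omega) v]
  omega

/-- The code determines a vertex among those of the same depth. -/
theorem Valid.eq_of_treeCode_eq (hn : 2 ≤ n) :
    ∀ {s : ℕ} {σ : PaletteState α}, σ.Valid n s → s ≤ n → ∀ v w : NaryVertex n s,
      naryDepth n s v = naryDepth n s w → σ.treeCode n s v = σ.treeCode n s w → v = w
  | 0, _, _, _, _, _, _, _ => rfl
  | _ + 1, _, _, _, none, none, _, _ => rfl
  | _ + 1, _, _, _, none, some (_, _), hd, _ => absurd hd (Nat.succ_ne_zero _).symm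
  | _ + 1, _, _, _, some (_, _), none, hd, _ => absurd hd (Nat.succ_ne_zero _)
  | s + 1, σ, h, hs, some (i, v), some (j, w), hd, hcode => by
    replace hd : naryDepth n s v = naryDepth n s w := Nat.succ_injective hd
    replace hcode : (σ.child n s i).treeCode n s v = (σ.child n s j).treeCode n s w := hcode
    have hi := h.child hn hs i
    have hj := h.child hn hs j
    have hcolor : (σ.child n s i).color = (σ.child n s j).color → i = j := fun e =>
      (finRotate n).injective (h.family_injective hs e)
    have hij : i = j := by
      by_cases h0 : naryDepth n s v = 0
      · obtain rfl := eq_naryRoot_of_depth h0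
        obtain rfl := eq_naryRoot_of_depth (hd.symm.trans h0)
        apply hcolor
        rw [treeCode_root, treeCode_root] at hcode
        exact (hj.code_eq_zero_iff.1 (hcode ▸ hi.code_eq_zero_iff.2 rfl)).symm
      · by_cases h2 : 2 ≤ s
        · by_contra hne
          have h1 := h.treeCode_family hn hs h2 i v
          -- The color withheld from branch `i` is not withheld from branch `j`, so its entry is too
          -- small there.
          have h3 := hj.treeCode_le hn (by omega) (miss_child_of_ne (h.miss_family hs i)
            ((h.family_injective hs).ne hne)) w
          rw [hcode] at h1
          omega
        · obtain rfl | rfl : s = 0 ∨ s = 1 := by omega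
          · exact absurd rfl h0
          · match v, w, h0, hd, hcode with
            | none, _, h0, _, _ => exact absurd rfl h0
            | some _, none, _, hd, _ => exact absurd hd (Nat.succ_ne_zero _)
            | some (i', v), some (j', w), _, _, hcode =>
              replace hcode : ((σ.child n 1 i).child n 0 i').code n 0 =
                ((σ.child n 1 j).child n 0 j').code n 0 := hcode
              have hi' := hi.child hn (by omega) i'
              have hj' := hj.child hn (by omega) j'
              have hne : (σ.child n 1 i).color ≠ ((σ.child n 1 i).child n 0 i').color :=
                (hi.family_ne_color (by omega) _).symm
              have h1 := hi'.code_pos hne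
              have h2 : ((σ.child n 1 i).child n 0 i').code n 0 (σ.child n 1 i).color ≤ 1 :=
                code_parent_le_one _
              have h3 := hi'.eq_parent_of_code_leaf (q := (σ.child n 1 i).color) (by omega)
              exact hcolor (hj'.eq_parent_of_code_leaf (hcode ▸ le_antisymm h2 h1))
    subst hij
    rw [hi.eq_of_treeCode_eq hn (by omega) v w hd hcode]

/-- The code determines the depth. -/
theorem Valid.treeCode_injective (hn : 2 ≤ n) {s : ℕ} {σ : PaletteState α}
    (h : σ.Valid n (s + 3)) (hs : s + 3 ≤ n) (h0 : ∀ q, σ.miss q = 0) :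
    Function.Injective (σ.treeCode n (s + 3)) := by
  have key : ∀ v w : NaryVertex n (s + 3), naryDepth n (s + 3) v < naryDepth n (s + 3) w →
      σ.treeCode n (s + 3) v ≠ σ.treeCode n (s + 3) w := by
    rintro v (_ | ⟨i, w⟩) hd hcode
    · exact absurd hd (Nat.not_lt_zero _)
    replace hd : naryDepth n (s + 3) v < naryDepth n (s + 2) w + 1 := hd
    replace hcode : σ.treeCode n (s + 3) v = (σ.child n (s + 2) i).treeCode n (s + 2) w := hcode
    by_cases hw : naryDepth n (s + 2) w = 0
    · obtain rfl := eq_naryRoot_of_depth hw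
      obtain rfl := eq_naryRoot_of_depth (v := v) (by omega)
      rw [treeCode_root, treeCode_root] at hcode
      have h1 := (h.child hn hs i).code_eq_zero_iff.1
        (hcode ▸ h.code_eq_zero_iff.2 rfl : _ = 0)
      exact h.family_ne_color hs _ h1
    · have h1 := h.treeCode_family hn hs (by omega) i w
      have h2 := h.treeCode_le hn hs (h0 (σ.family n i)) v
      rw [hcode] at h2
      omega
  intro v w hcode
  rcases lt_trichotomy (naryDepth n (s + 3) v) (naryDepth n (s + 3) w) with hd | hd | hd
  · exact absurd hcode (key v w hd)
  · exact h.eq_of_treeCode_eq hn hs v w hd hcode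
  · exact absurd hcode.symm (key w v hd)

theorem exists_initial {s : ℕ} (hα : Fintype.card α = n + s + 2) :
    ∃ σ : PaletteState α, σ.Valid n (s + 3) ∧ (∀ q, σ.miss q = 0) ∧ σ.parent = σ.color := by
  have : Nonempty α := Fintype.card_pos_iff.1 (by omega)
  obtain ⟨c⟩ := this
  -- The root has no parent; its own color stands in, so that the parent clause of `code` never
  -- applies.
  refine ⟨⟨c, c, fun _ => 0, ∅⟩, ⟨rfl, rfl, fun _ => zero_ne_one, Finset.empty_subset _,
    Nat.zero_le _, ?_⟩, fun _ => rfl, rfl⟩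
  have : (⟨c, c, fun _ => 0, ∅⟩ : PaletteState α).available = Finset.univ.erase c := by
    ext q
    simp [mem_available]
  rw [this, Finset.card_erase_of_mem (Finset.mem_univ c), Finset.card_univ, hα]
  omega

end PaletteState

/-! ### The exact value and the limit -/

theorem exists_isLocatingColoring {n s : ℕ} (hs : s + 3 ≤ n) :
    ∃ c : NaryVertex n (s + 3) → Fin (n + s + 2),
      IsLocatingColoring (naryTree n (s + 3)) c := by
  have hn : 2 ≤ n := by omega
  obtain ⟨σ, hσ, h0, hp⟩ := PaletteState.exists_initial (α := Fin (n + s + 2)) (n := n) (s := s)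
    (Fintype.card_fin _)
  have hconn := naryTree_connected n (s + 3)
  have hzero := fun q => hσ.treeCode_eq_zero_iff hn (q := q) hs
  have hdesc : ∀ q v, σ.treeCode n (s + 3) v q ≠ 0 → ∃ w, (naryTree n (s + 3)).Adj v w ∧
      σ.treeCode n (s + 3) v q = σ.treeCode n (s + 3) w q + 1 := by
    intro q v hq
    obtain h | ⟨rfl, h | h | h⟩ := hσ.exists_adj_treeCode hn hs v hq
    · exact h
    · refine absurd ((hzero q _).2 ?_) hq
      rw [PaletteState.treeColor_root, h, hp]
    · exact absurd (h0 q) h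
    · omega
  refine ⟨σ.treeColor n (s + 3), hσ.treeColor_ne hn hs, fun q => ?_, ?_⟩
  · obtain ⟨x, hx, -⟩ := exists_dist_le_of_local hconn (fun v => σ.treeCode n (s + 3) v q)
      (hzero q) (hdesc q) (naryRoot n (s + 3))
    exact ⟨x, hx⟩
  · have : colorCode (naryTree n (s + 3)) (σ.treeColor n (s + 3)) = σ.treeCode n (s + 3) := by
      funext v q
      exact distToClass_eq_of_local hconn (fun v => σ.treeCode n (s + 3) v q)
        (hzero q) (hσ.treeCode_le_succ hn hs) (hdesc q) v
    rw [this]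
    exact hσ.treeCode_injective hn hs h0

theorem locatingChromaticNumber_naryTree {n s : ℕ} (hs : s + 3 ≤ n)
    (hlarge : (2 * (2 * (s + 3) + 1)) ^ (s + 1) < n) :
    locatingChromaticNumber (naryTree n (s + 3)) = n + s + 2 := by
  have hmem : n + s + 2 ∈ {m : ℕ | 0 < m ∧ ∃ c : NaryVertex n (s + 3) → Fin m,
      IsLocatingColoring (naryTree n (s + 3)) c} :=
    ⟨by omega, exists_isLocatingColoring hs⟩
  apply le_antisymm (Nat.sInf_le hmem)
  obtain ⟨hpos, c, hc⟩ := Nat.sInf_mem ⟨_, hmem⟩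
  exact le_of_isLocatingColoring hpos (by omega) hlarge hc

theorem mainTheorem2 (k : ℕ) (hk : 4 ≤ k) :
    Filter.Tendsto (fun n : ℕ => (locatingChromaticNumber (naryTree n k) : ℝ) - (n : ℝ))
      Filter.atTop (nhds ((k : ℝ) - 1)) := by
  obtain ⟨s, rfl⟩ := Nat.exists_eq_add_of_le' (show 3 ≤ k by omega)
  apply tendsto_const_nhds.congr'
  filter_upwards [Filter.eventually_ge_atTop (s + 3),
    Filter.eventually_gt_atTop ((2 * (2 * (s + 3) + 1)) ^ (s + 1))] with n hs hlarge
  rw [locatingChromaticNumber_naryTree hs hlarge]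
  push_cast
  ring
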